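/- Let $k$ be a field of characteristic zero, let $E$ be a $k$-vector space of finite dimension $n$, and let $Sl_n = SL(E)$ be the special linear group of $E$, regarded as an algebraic group over $k$. For $m \ge 0$ let it act on $E^{\otimes m} = E \otimes_k \overset{m}{\cdots} \otimes_k E$ by $g\cdot(v_1\otimes\cdots\otimes v_m) = g v_1\otimes\cdots\otimes g v_m$. Let $(E^{\otimes m})^{Sl_n}$ be the space of invariants, that is, of the tensors $x \in E^{\otimes m}$ whose image in $(B\otimes_k E)^{\otimes_B m} = B \otimes_k E^{\otimes m}$ is fixed by every $g \in SL(B\otimes_k E)$, for every commutative $k$-algebra $B$. (Since $k$ is infinite, these are exactly the tensors fixed by every element of the group $SL(E)$ of $k$-rational points; this is included as part of the claim.) Then: 1. $(E^{\otimes n})^{Sl_n} = \Lambda^n E$, where $\Lambda^n E$ is embedded in $E^{\otimes n}$ by the injective linear map $v_1\wedge\cdots\wedge v_n \mapsto \sum_{\sigma\in S_n} \mathrm{sgn}(\sigma)\, v_{\sigma(1)}\otimes\cdots\otimes v_{\sigma(n)}$. 2. For every $m \ge 0$, $$(E^{\otimes nm})^{Sl_n} = \sum_{\sigma\in S_{nm}}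 \sigma\big(\Lambda^n E\otimes\overset{m}{\cdots}\otimes\Lambda^n E\big),$$ where $\Lambda^n E\otimes\overset{m}{\cdots}\otimes\Lambda^n E \subseteq E^{\otimes n}\otimes\overset{m}{\cdots}\otimes E^{\otimes n} = E^{\otimes nm}$ and $\sigma \in S_{nm}$ acts on $E^{\otimes nm}$ by permuting the factors. 3. For every $m \ge 0$ that is not a multiple of $n$, $(E^{\otimes m})^{Sl_n} = 0$. -/

import Mathlib

open scoped TensorProduct

namespace TensorInvariants

universe u v

noncomputable section

section

variable (k : Type u) [Field k] (E : Type v) [AddCommGroup E] [Module k E]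

/-- The canonical extension-of-scalars map `E^{⊗m} → (B ⊗ E)^{⊗_B m}`,
`v₁ ⊗ ⋯ ⊗ v_m ↦ (1 ⊗ v₁) ⊗ ⋯ ⊗ (1 ⊗ v_m)`. -/
def extendScalars (B : Type u) [CommRing B] [Algebra k B] (m : ℕ) :
    (⨂[k]^m E) →ₗ[k] (⨂[B]^m (B ⊗[k] E)) :=
  PiTensorProduct.lift
    (((PiTensorProduct.tprod B : MultilinearMap B (fun _ : Fin m => B ⊗[k] E) _).restrictScalars
      k).compLinearMap (fun _ => TensorProduct.mk k B E 1))

/-- The diagonal action on the tensor power `V^{⊗m}` over `R` of an element `g` of `SL(V)`: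
`g (v₁ ⊗ ⋯ ⊗ v_m) = g v₁ ⊗ ⋯ ⊗ g v_m`. -/
def diagAction (R : Type*) [CommRing R] (V : Type*) [AddCommGroup V] [Module R V] (m : ℕ)
    (g : SpecialLinearGroup R V) : (⨂[R]^m V) →ₗ[R] (⨂[R]^m V) :=
  PiTensorProduct.map (fun _ => (g : V →ₗ[R] V))

/-- The invariants `(E^{⊗m})^{SL(E)}` of the algebraic group `SL(E)` over `k`: the tensors that are
fixed by all points `g ∈ SL(E)(B) = SL(B ⊗ E)`, for all commutative `k`-algebras `B`. -/
def slInvariants (m : ℕ) : Submodule k (⨂[k]^m E) where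
  carrier := {x | ∀ (B : Type u) [CommRing B] [Algebra k B]
    (g : SpecialLinearGroup B (B ⊗[k] E)),
      diagAction B (B ⊗[k] E) m g (extendScalars k E B m x) = extendScalars k E B m x}
  zero_mem' := by intro B _ _ g; simp
  add_mem' := by
    intro x y hx hy B _ _ g
    rw [map_add, map_add, hx B g, hy B g]
  smul_mem' := by
    intro c x hx B _ _ g
    have h : extendScalars k E B m (c • x) = algebraMap k B c • extendScalars k E B m x := by
      rw [map_smul, algebraMap_smul]
    rw [h, map_smul, hx B g]

/-- The exterior power `Λⁿ E` as a subspace of `E^{⊗n}`: the span of the antisymmetrized tensors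
`∑_σ sgn(σ) v_{σ(1)} ⊗ ⋯ ⊗ v_{σ(n)}`. -/
def wedge (n : ℕ) : Submodule k (⨂[k]^n E) :=
  LinearMap.range (exteriorPower.toTensorPower k E n)

variable {k E}

/-- The concatenation product `E^{⊗a} × E^{⊗b} → E^{⊗(a+b)}`. -/
def concat (a b : ℕ) : (⨂[k]^a E) →ₗ[k] (⨂[k]^b E) →ₗ[k] (⨂[k]^(a + b) E) :=
  (TensorProduct.mk k _ _).compr₂
    ((TensorPower.mulEquiv : (⨂[k]^a E) ⊗[k] (⨂[k]^b E) ≃ₗ[k] (⨂[k]^(a + b) E)) : _ →ₗ[k] _)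

/-- For a subspace `W` of `E^{⊗n}`, the subspace `W ⊗ ⋯ ⊗ W` (`m` factors) of `E^{⊗nm}`: the span
of the concatenations `w₁ ⊗ ⋯ ⊗ w_m` with all `w_i ∈ W`. -/
def blockPower {n : ℕ} (W : Submodule k (⨂[k]^n E)) :
    (m : ℕ) → Submodule k (⨂[k]^(n * m) E)
  | 0 => (⊤ : Submodule k (⨂[k]^0 E))
  | m + 1 => Submodule.map₂ (concat (n * m) n) (blockPower W m) W

/-- The action of a permutation `σ` on `E^{⊗m}` by permuting the factors: the factor in
position `i` is moved to position `σ i`. -/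
def permAction {m : ℕ} (σ : Equiv.Perm (Fin m)) : (⨂[k]^m E) →ₗ[k] (⨂[k]^m E) :=
  ((PiTensorProduct.reindex k (fun _ : Fin m => E) σ : (⨂[k]^m E) ≃ₗ[k] (⨂[k]^m E)) : _ →ₗ[k] _)

end

end

end TensorInvariants

/-! ### Polarization and the averaging argument -/

namespace TensorInvariants

open Equiv Finset

/-! Let `T` be fixed by the rational points of `SL(E)`. Diagonal matrices of determinant 1 force
every index tuple in the support of `T` to use each basis vector equally often, so `T = 0` unless
the degree is `n * m`. In that degree every endomorphism, singular ones included, satisfies `φ^{⊗nm}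
T = det(φ)^m T` (`map_eq_det_pow_smul`).

Both sides are restrictions to the diagonal of maps multilinear in `nm` endomorphisms, so their
symmetrizations agree. Evaluate these at matrix units with rows `p` and columns `q`, weight by the
coefficients `s p` of an expansion of `det^m`, and sum over `p`. One side becomes a combination of
place permutations of a single element of `Λⁿ ⊗ ⋯ ⊗ Λⁿ`; the other is `C • T` with `C` a nonzero
integer, invertible in characteristic zero (`mem_iSup_map_permAction`).

Conversely, over any `B` an element of `SL` acts trivially on antisymmetrized tensors of top degree,
and invariance survives concatenation and place permutations. Hence functorial invariants, tensors
fixed by rational points and the sum of permuted blocks all coincide. -/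

/-- Polarization: a multilinear map vanishing on the diagonal has vanishing symmetrization. -/
theorem sum_perm_eq_zero_of_diagonal {ι R M W : Type*} [Fintype ι] [DecidableEq ι] [CommRing R]
    [AddCommGroup M] [Module R M] [AddCommGroup W] [Module R W]
    (f : MultilinearMap R (fun _ : ι => M) W) (hf : ∀ x, f (fun _ => x) = 0) (g : ι → M) :
    ∑ σ : Perm ι, f (fun i => g (σ i)) = 0 := by
  -- Inclusion-exclusion over the partial sums of `g`: after expansion only the bijective index maps
  -- survive.
  have key : ∑ S : Finset ι, (-1 : R) ^ S.card •
      f (fun _ => ∑ i, (if i ∈ S then (1 : R) else 0) • g i) = 0 := by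
    simp [hf]
  have coeff (r : ι → ι) : ∑ S : Finset ι, (-1 : R) ^ S.card *
      ∏ a, (if r a ∈ S then (1 : R) else 0) =
        if Function.Bijective r then (-1 : R) ^ Fintype.card ι else 0 := by
    split_ifs with hr
    · rw [Finset.sum_eq_single univ]
      · simp [Finset.card_univ]
      · intro S _ hS
        obtain ⟨i, hi⟩ : ∃ i, i ∉ S := by
          by_contra! h
          exact hS (Finset.eq_univ_iff_forall.2 h)
        obtain ⟨a, rfl⟩ := hr.2 i
        rw [Finset.prod_eq_zero (mem_univ a) (by simp [hi]), mul_zero]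
      · simp
    · have hr' : ¬ Function.Surjective r := fun h => hr (Finite.injective_iff_bijective.1
        (Finite.injective_iff_surjective.2 h))
      simp only [Function.Surjective, not_forall, not_exists] at hr'
      obtain ⟨i, hi⟩ := hr'
      -- The coefficient is the expansion of a product over `j`, whose factor at the missed index
      -- `i` is `-1 + 1`.
      have h := Finset.prod_add (fun _ : ι => (-1 : R))
        (fun j => if j ∈ Set.range r then (0 : R) else 1) univ
      rw [Finset.prod_eq_zero (mem_univ i) (by simp [hi])] at h
      rw [Finset.powerset_univ] at h
      refine Eq.trans ?_ h.symm
      refine Finset.sum_congr rfl fun S _ => ?_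
      rw [Finset.prod_const]
      congr 1
      by_cases hS : ∀ a, r a ∈ S
      · rw [Finset.prod_eq_one, Finset.prod_eq_one]
        · intro j hj
          rw [if_neg]
          rintro ⟨a, rfl⟩
          simp [hS a] at hj
        · intro a _
          simp [hS a]
      · push Not at hS
        obtain ⟨a, ha⟩ := hS
        exact (Finset.prod_eq_zero (mem_univ a) (if_neg ha)).trans
          (Finset.prod_eq_zero (i := r a) (by simp [ha]) (by simp)).symm
  have expand (S : Finset ι) : f (fun _ => ∑ i, (if i ∈ S then (1 : R) else 0) • g i) =
      ∑ r : ι → ι, (∏ a, (if r a ∈ S then (1 : R) else 0)) • f (fun a => g (r a)) := by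
    rw [f.map_sum]
    exact Finset.sum_congr rfl fun r _ => f.map_smul_univ _ _
  simp_rw [expand, Finset.smul_sum, smul_smul] at key
  rw [Finset.sum_comm] at key
  simp_rw [← Finset.sum_smul, coeff, ite_smul, zero_smul] at key
  rw [← Finset.sum_filter, ← Finset.smul_sum] at key
  have h2 : ∑ r : ι → ι with Function.Bijective r, f (fun a => g (r a)) = 0 := by
    have := congrArg (fun w => (-1 : R) ^ Fintype.card ι • w) key
    simpa [smul_smul, ← mul_pow] using this
  rw [← h2]
  refine Finset.sum_bij (fun σ _ => (σ : ι → ι)) ?_ ?_ ?_ ?_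
  · intro σ _
    simp
  · intro σ _ τ _ h
    exact DFunLike.coe_injective h
  · intro r hr
    exact ⟨Equiv.ofBijective r (by simpa using hr), mem_univ _, rfl⟩
  · intros
    rfl

/-- The correlation of a function `s` with its average over the stabilizer of `q` is nonzero as
soon as `s q ≠ 0`. -/
theorem sum_mul_stabilizer_ne_zero {α ι : Type*} [Fintype α] [DecidableEq α] [Fintype ι]
    [DecidableEq ι] (s : (α → ι) → ℤ) (q : α → ι) (hs : s q ≠ 0) :
    ∑ p, s p * ∑ τ : Perm α, (if q ∘ τ = q then s (p ∘ τ) else 0) ≠ 0 := by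
  set F : (α → ι) → ℤ := fun p => ∑ τ : Perm α, (if q ∘ τ = q then s (p ∘ τ) else 0) with hF
  change ∑ p, s p * F p ≠ 0
  have hinv (ρ : Perm α) (hρ : q ∘ ρ = q) (p : α → ι) : F (p ∘ ρ) = F p := by
    simp only [hF]
    rw [← Equiv.sum_comp (Equiv.mulLeft ρ) (fun τ => if q ∘ τ = q then s (p ∘ τ) else 0)]
    refine Finset.sum_congr rfl fun τ _ => ?_
    simp only [Equiv.coe_mulLeft, Perm.coe_mul, ← Function.comp_assoc, hρ]
  have hshift (ρ : Perm α) (hρ : q ∘ ρ = q) : ∑ p, s (p ∘ ρ) * F p = ∑ p, s p * F p := by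
    rw [← Equiv.sum_comp (Equiv.arrowCongr ρ⁻¹ (Equiv.refl ι)) (fun p => s p * F p)]
    refine Finset.sum_congr rfl fun p _ => ?_
    have : Equiv.arrowCongr ρ⁻¹ (Equiv.refl ι) p = p ∘ ρ := rfl
    rw [this, hinv ρ hρ]
  -- `F` is invariant under the stabilizer of `q`, so its square norm is the stabilizer's order
  -- times the correlation. If the latter vanished, so would `F`; but `F q` is that order times `s
  -- q`.
  have hsq : ∑ p, F p * F p =
      (∑ τ : Perm α, if q ∘ τ = q then (1 : ℤ) else 0) * ∑ p, s p * F p := by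
    have : ∀ p, F p * F p = ∑ τ : Perm α, if q ∘ τ = q then s (p ∘ τ) * F p else 0 := by
      intro p
      conv_lhs => rw [hF]
      simp only [Finset.sum_mul, ite_mul, zero_mul, hF]
    simp_rw [this]
    rw [Finset.sum_comm, Finset.sum_mul]
    refine Finset.sum_congr rfl fun τ _ => ?_
    split_ifs with h
    · rw [hshift τ h, one_mul]
    · simp
  intro h0
  rw [h0, mul_zero] at hsq
  have hFq : F q = 0 := by
    have := (Finset.sum_eq_zero_iff_of_nonneg (fun p _ => mul_self_nonneg (F p))).1 hsq q
      (mem_univ q)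
    simpa using this
  have hFq' : F q = (∑ τ : Perm α, if q ∘ τ = q then (1 : ℤ) else 0) * s q := by
    simp only [hF, Finset.sum_mul, ite_mul, zero_mul, one_mul]
    refine Finset.sum_congr rfl fun τ _ => ?_
    split_ifs with h
    · rw [h]
    · rfl
  have hpos : 0 < ∑ τ : Perm α, if q ∘ τ = q then (1 : ℤ) else 0 := by
    refine Finset.sum_pos' (fun τ _ => by split_ifs <;> norm_num) ⟨1, mem_univ _, ?_⟩
    simp
  rw [hFq'] at hFq
  exact mul_ne_zero hpos.ne' hs hFq

variable {k E ι : Type*} [Field k] [AddCommGroup E] [Module k E]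

@[simp]
theorem permAction_tprod {m : ℕ} (σ : Perm (Fin m)) (v : Fin m → E) :
    permAction σ (PiTensorProduct.tprod k v) = PiTensorProduct.tprod k (v ∘ σ.symm) :=
  PiTensorProduct.reindex_tprod σ v

@[simp]
theorem concat_tprod {a c : ℕ} (v : Fin a → E) (w : Fin c → E) :
    concat a c (PiTensorProduct.tprod k v) (PiTensorProduct.tprod k w) =
      PiTensorProduct.tprod k (Fin.append v w) :=
  TensorPower.tprod_mul_tprod k v w

/-- A tensor on which all endomorphisms act through a power of the determinant is a combination of
place permutations of any tensor whose coefficients expand that power of the determinant. -/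
theorem mem_iSup_map_permAction [CharZero k] [Fintype ι] [DecidableEq ι]
    (b : Module.Basis ι k E) {N m : ℕ} (T : ⨂[k]^N E)
    (hT : ∀ φ : E →ₗ[k] E, PiTensorProduct.map (fun _ => φ) T = LinearMap.det φ ^ m • T)
    (q : Fin N → ι) (s : (Fin N → ι) → ℤ) (hs : s q ≠ 0)
    (hdet : ∀ φ : E →ₗ[k] E, LinearMap.det φ ^ m =
      ∑ p, (s p : k) * ∏ a, b.coord (p a) (φ (b (q a))))
    (W : Submodule k (⨂[k]^N E))
    (hW : ∑ p, (s p : k) • PiTensorProduct.tprod k (b ∘ p) ∈ W) :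
    T ∈ ⨆ σ : Perm (Fin N), W.map (permAction σ) := by
  let entry (i j : ι) : (E →ₗ[k] E) →ₗ[k] k := (b.coord i).comp (LinearMap.applyₗ (b j))
  let h (p : Fin N → ι) : MultilinearMap k (fun _ : Fin N => E →ₗ[k] E) k :=
    (MultilinearMap.mkPiAlgebra k (Fin N) k).compLinearMap (fun a => entry (p a) (q a))
  let f : MultilinearMap k (fun _ : Fin N => E →ₗ[k] E) (⨂[k]^N E) :=
    (LinearMap.applyₗ T).compMultilinearMap (PiTensorProduct.mapMultilinear k _ _)
  let f' : MultilinearMap k (fun _ : Fin N => E →ₗ[k] E) (⨂[k]^N E) :=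
    (LinearMap.toSpanSingleton k _ T).compMultilinearMap (∑ p, (s p : k) • h p)
  have hf (g) : f g = PiTensorProduct.map g T := rfl
  have hf' (g) : f' g = (∑ p, (s p : k) * ∏ a, b.coord (p a) (g a (b (q a)))) • T := by
    simp [f', h, entry, Finset.sum_smul]
  -- `f` and `f'` agree on the diagonal by `hT` and `hdet`.
  have hpol (g : Fin N → (E →ₗ[k] E)) : ∑ τ : Perm (Fin N), f (fun a => g (τ a)) =
      ∑ τ : Perm (Fin N), f' (fun a => g (τ a)) := by
    rw [← sub_eq_zero, ← Finset.sum_sub_distrib]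
    refine sum_perm_eq_zero_of_diagonal (f - f') (fun φ => ?_) g
    rw [sub_apply, hf, hf', hT, hdet, sub_self]
  -- Matrix units: `elem i j` sends `b j` to `b i` and kills the other basis vectors.
  let elem (i j : ι) : E →ₗ[k] E := (b.coord j).smulRight (b i)
  let c (J : Fin N → ι) : (⨂[k]^N E) →ₗ[k] k := PiTensorProduct.lift
    ((MultilinearMap.mkPiAlgebra k (Fin N) k).compLinearMap (fun a => b.coord (J a)))
  have hmap (I J : Fin N → ι) : PiTensorProduct.map (fun a => elem (I a) (J a)) T =
      c J T • PiTensorProduct.tprod k (b ∘ I) := by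
    have : PiTensorProduct.map (fun a => elem (I a) (J a)) =
        (c J).smulRight (PiTensorProduct.tprod k (b ∘ I)) := by
      ext v
      simp only [LinearMap.compMultilinearMap_apply, PiTensorProduct.map_tprod,
        LinearMap.smulRight_apply, c, PiTensorProduct.lift.tprod, elem]
      rw [MultilinearMap.map_smul_univ]
      rfl
    rw [this, LinearMap.smulRight_apply]
  have hentry (p I J : Fin N → ι) : ∏ a, b.coord (p a) (elem (I a) (J a) (b (q a))) =
      if q = J then (if p = I then 1 else 0) else (0 : k) := by
    have : ∀ a, b.coord (p a) (elem (I a) (J a) (b (q a))) =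
        if q a = J a then (if p a = I a then 1 else 0) else 0 := by
      intro a
      by_cases h1 : q a = J a <;> by_cases h2 : p a = I a <;>
        simp [elem, h1, h2, eq_comm]
    simp_rw [this]
    split_ifs with h1 h2
    · subst h1 h2
      simp
    · obtain ⟨a, ha⟩ := Function.ne_iff.1 h2
      exact Finset.prod_eq_zero (mem_univ a) (by simp [ha])
    · obtain ⟨a, ha⟩ := Function.ne_iff.1 h1
      exact Finset.prod_eq_zero (mem_univ a) (by simp [ha])
  set C : ℤ := ∑ p, s p * ∑ τ : Perm (Fin N), (if q ∘ τ = q then s (p ∘ τ) else 0) with hC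
  have hC0 : C ≠ 0 := sum_mul_stabilizer_ne_zero s q hs
  -- On the determinant side only the `τ` stabilizing `q` contribute.
  have hR : ∑ p, (s p : k) • ∑ τ : Perm (Fin N), f' (fun a => elem (p (τ a)) (q (τ a))) =
      (C : k) • T := by
    simp_rw [hf']
    have : ∀ (p : Fin N → ι) (τ : Perm (Fin N)), ∑ p', (s p' : k) *
        ∏ a, b.coord (p' a) (elem (p (τ a)) (q (τ a)) (b (q a))) =
        if q ∘ τ = q then (s (p ∘ τ) : k) else 0 := by
      intro p τ
      have h3 := fun p' => hentry p' (p ∘ τ) (q ∘ τ)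
      simp only [Function.comp_apply] at h3
      simp_rw [h3]
      by_cases hq : q ∘ τ = q
      · simp [hq]
      · simp [hq, Ne.symm hq]
    simp_rw [this, ← Finset.sum_smul, smul_smul]
    rw [← Finset.sum_smul, hC]
    push_cast
    rfl
  have hL : ∑ p, (s p : k) • ∑ τ : Perm (Fin N), f (fun a => elem (p (τ a)) (q (τ a))) =
      ∑ τ : Perm (Fin N), c (q ∘ τ) T • permAction τ⁻¹
        (∑ p, (s p : k) • PiTensorProduct.tprod k (b ∘ p)) := by
    simp_rw [Finset.smul_sum, map_sum, map_smul, Finset.smul_sum]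
    rw [Finset.sum_comm]
    refine Finset.sum_congr rfl fun τ _ => Finset.sum_congr rfl fun p _ => ?_
    have h3 := hmap (p ∘ τ) (q ∘ τ)
    simp only [Function.comp_apply] at h3
    rw [hf, h3, permAction_tprod, smul_comm]
    rfl
  have hCT : (C : k) • T = ∑ τ : Perm (Fin N), c (q ∘ τ) T • permAction τ⁻¹
        (∑ p, (s p : k) • PiTensorProduct.tprod k (b ∘ p)) := by
    rw [← hR, ← hL]
    exact Finset.sum_congr rfl fun p _ => by rw [hpol (fun a => elem (p a) (q a))]
  have hTmem : T = (C : k)⁻¹ • (C : k) • T := by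
    rw [smul_smul, inv_mul_cancel₀ (Int.cast_ne_zero.2 hC0), one_smul]
  rw [hTmem, hCT]
  refine Submodule.smul_mem _ _ (Submodule.sum_mem _ fun τ _ => Submodule.smul_mem _ _ ?_)
  exact Submodule.mem_iSup_of_mem τ⁻¹ (Submodule.mem_map_of_mem hW)

end TensorInvariants

/-! ### Determinant expansions and antisymmetrized tensors -/

namespace TensorInvariants

open Equiv Finset

variable {k E : Type*} [Field k] [AddCommGroup E] [Module k E] {n : ℕ}

/-- The sign of a self-map of `Fin n`, zero if the map is not bijective. -/
def signCoeff (p : Fin n → Fin n) : ℤ :=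
  ∑ σ : Perm (Fin n), if p = σ then (Perm.sign σ : ℤ) else 0

theorem signCoeff_id : signCoeff (id : Fin n → Fin n) = 1 := by
  rw [signCoeff, Finset.sum_eq_single 1]
  · simp
  · intro σ _ hσ
    rw [if_neg]
    intro h
    exact hσ (Equiv.ext fun i => (congrFun h i).symm)
  · simp

theorem sum_signCoeff_smul {W : Type*} [AddCommGroup W] [Module k W]
    (F : (Fin n → Fin n) → W) :
    ∑ p, (signCoeff p : k) • F p = ∑ σ : Perm (Fin n), Perm.sign σ • F σ := by
  simp_rw [signCoeff, Int.cast_sum, Finset.sum_smul]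
  rw [Finset.sum_comm]
  refine Finset.sum_congr rfl fun σ _ => ?_
  rw [Finset.sum_eq_single (σ : Fin n → Fin n)]
  · rw [if_pos rfl, Int.cast_smul_eq_zsmul, Units.smul_def]
  · intro p _ hp
    simp [hp]
  · simp

/-- The integers that expand the determinant also build the antisymmetrized tensor; this double role
is what makes the averaged tensor land in the wedge blocks. -/
theorem sum_signCoeff_tprod (v : Fin n → E) :
    ∑ p : Fin n → Fin n, (signCoeff p : k) • PiTensorProduct.tprod k (v ∘ p) =
      exteriorPower.toTensorPower k E n (exteriorPower.ιMulti k n v) := by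
  rw [exteriorPower.toTensorPower_apply_ιMulti,
    sum_signCoeff_smul (fun p => PiTensorProduct.tprod k (v ∘ p))]
  rfl

theorem det_eq_sum_signCoeff (b : Module.Basis (Fin n) k E) (φ : E →ₗ[k] E) :
    LinearMap.det φ = ∑ p, (signCoeff p : k) * ∏ a, b.coord (p a) (φ (b a)) := by
  have := sum_signCoeff_smul (k := k) (fun p : Fin n → Fin n => ∏ a, b.coord (p a) (φ (b a)))
  simp only [smul_eq_mul] at this
  rw [this, ← LinearMap.det_toMatrix b, Matrix.det_apply]
  simp [LinearMap.toMatrix_apply]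

theorem sum_eq_sum_append {α W : Type*} [Fintype α] [AddCommMonoid W] {a c : ℕ}
    (F : (Fin (a + c) → α) → W) :
    ∑ p, F p = ∑ p : Fin a → α, ∑ p' : Fin c → α, F (Fin.append p p') := by
  rw [← Equiv.sum_comp (Fin.appendEquiv a c), Fintype.sum_prod_type]
  rfl

/-- Expansion of the powers of the determinant, compatible with the block structure. -/
theorem exists_det_pow_expansion (b : Module.Basis (Fin n) k E) (m : ℕ) :
    ∃ (q : Fin (n * m) → Fin n) (s : (Fin (n * m) → Fin n) → ℤ), s q ≠ 0 ∧
      (∀ φ : E →ₗ[k] E, LinearMap.det φ ^ m =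
        ∑ p, (s p : k) * ∏ a, b.coord (p a) (φ (b (q a)))) ∧
      ∑ p, (s p : k) • PiTensorProduct.tprod k (b ∘ p) ∈ blockPower (wedge k E n) m := by
  induction m with
  | zero =>
    have : IsEmpty (Fin (n * 0)) := by rw [mul_zero]; infer_instance
    refine ⟨isEmptyElim, fun _ => 1, one_ne_zero, fun φ => ?_, ?_⟩
    · simp
    · exact Submodule.mem_top
  | succ m ih =>
    obtain ⟨q, s, hs, hdet, hmem⟩ := ih
    -- `q` lists all columns once per block, and `s` is the product of the signs of the blocks.
    refine ⟨Fin.append q id, fun p : Fin (n * m + n) → Fin n =>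
      s (fun a => p (Fin.castAdd n a)) * signCoeff (fun a => p (Fin.natAdd (n * m) a)), ?_, ?_, ?_⟩
    · simpa [signCoeff_id, ← Function.id_def] using hs
    · intro φ
      refine Eq.trans ?_ (sum_eq_sum_append (fun p : Fin (n * m + n) → Fin n =>
        ((s (fun a => p (Fin.castAdd n a)) * signCoeff (fun a => p (Fin.natAdd (n * m) a)) : ℤ) :
          k) * ∏ a, b.coord (p a) (φ (b (Fin.append q id a))))).symm
      rw [pow_succ, hdet, det_eq_sum_signCoeff b, Finset.sum_mul_sum]
      refine Finset.sum_congr rfl fun p _ => Finset.sum_congr rfl fun p' _ => ?_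
      simp only [Fin.prod_univ_add, Fin.append_left, Fin.append_right, id]
      push_cast
      ring
    · have h1 : concat (n * m) n (∑ p, (s p : k) • PiTensorProduct.tprod k (b ∘ p))
          (∑ p : Fin n → Fin n, (signCoeff p : k) • PiTensorProduct.tprod k (b ∘ p)) ∈
          blockPower (wedge k E n) (m + 1) := by
        refine Submodule.apply_mem_map₂ _ hmem ?_
        rw [sum_signCoeff_tprod]
        exact LinearMap.mem_range_self _ _
      refine Eq.subst (motive := fun x => x ∈ blockPower (wedge k E n) (m + 1)) ?_ h1
      refine Eq.trans ?_ (sum_eq_sum_append (fun p : Fin (n * m + n) → Fin n =>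
        ((s (fun a => p (Fin.castAdd n a)) * signCoeff (fun a => p (Fin.natAdd (n * m) a)) : ℤ) :
          k) • PiTensorProduct.tprod k (b ∘ p))).symm
      simp only [map_sum, LinearMap.sum_apply, map_smul, LinearMap.smul_apply, Finset.smul_sum,
        concat_tprod]
      rw [Finset.sum_comm]
      refine Finset.sum_congr rfl fun p _ => Finset.sum_congr rfl fun p' _ => ?_
      simp only [Fin.append_left, Fin.append_right, Int.cast_mul, mul_smul]
      rw [smul_comm]
      congr 3
      ext a
      refine Fin.addCases (fun i => ?_) (fun i => ?_) a <;> simp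

theorem wedge_eq_span : wedge k E n = Submodule.span k (Set.range fun v : Fin n → E =>
    exteriorPower.toTensorPower k E n (exteriorPower.ιMulti k n v)) := by
  rw [wedge, LinearMap.range_eq_map, ← exteriorPower.ιMulti_span, Submodule.map_span,
    ← Set.range_comp]
  rfl

/-- Moving factors by `σ` antisymmetrizes `v ∘ σ.symm` instead, since conjugation preserves signs.
This collapses the sum over permutations in degree `n`. -/
theorem map_permAction_wedge_le (σ : Perm (Fin n)) :
    (wedge k E n).map (permAction σ) ≤ wedge k E n := by
  conv_lhs => rw [wedge_eq_span]
  rw [Submodule.map_span_le]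
  rintro _ ⟨v, rfl⟩
  have : permAction σ (exteriorPower.toTensorPower k E n (exteriorPower.ιMulti k n v)) =
      exteriorPower.toTensorPower k E n (exteriorPower.ιMulti k n (v ∘ σ.symm)) := by
    rw [exteriorPower.toTensorPower_apply_ιMulti, exteriorPower.toTensorPower_apply_ιMulti,
      map_sum, ← Equiv.sum_comp (MulAut.conj σ⁻¹).toEquiv]
    refine Finset.sum_congr rfl fun τ _ => ?_
    rw [Units.smul_def, map_zsmul, permAction_tprod, ← Units.smul_def]
    congr 1
    · simp [mul_comm (Perm.sign σ), mul_assoc]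
    · congr 1
      ext i
      simp
  rw [this]
  exact LinearMap.mem_range_self _ _

/-! ### Tensors fixed by the group of rational points -/

variable {N : ℕ}

theorem piTensorProduct_repr_map_diagonal (b : Module.Basis (Fin n) k E) (D : Fin n → k)
    (T : ⨂[k]^N E) (I : Fin N → Fin n) :
    (Basis.piTensorProduct (fun _ : Fin N => b)).repr
        (PiTensorProduct.map (fun _ => Matrix.toLin b b (Matrix.diagonal D)) T) I =
      (∏ a, D (I a)) * (Basis.piTensorProduct (fun _ : Fin N => b)).repr T I := by
  have hD (v : E) (i : Fin n) :
      b.repr (Matrix.toLin b b (Matrix.diagonal D) v) i = D i * b.repr v i := by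
    rw [Matrix.repr_toLin]
    simp [Matrix.mulVec_diagonal]
  have : ((Basis.piTensorProduct (fun _ : Fin N => b)).coord I).comp
      (PiTensorProduct.map (fun _ => Matrix.toLin b b (Matrix.diagonal D))) =
      (∏ a, D (I a)) • (Basis.piTensorProduct (fun _ : Fin N => b)).coord I := by
    ext v
    simp [Basis.piTensorProduct_repr_tprod_apply, hD, Finset.prod_mul_distrib]
  simpa using congrArg (fun f => f T) this

theorem map_toLin_eq_of_forall_diagAction (b : Module.Basis (Fin n) k E) {T : ⨂[k]^N E}
    (hT : ∀ g : SpecialLinearGroup k E, diagAction k E N g T = T)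
    (M : Matrix (Fin n) (Fin n) k) (hM : M.det = 1) :
    PiTensorProduct.map (fun _ => Matrix.toLin b b M) T = T := by
  let A : Matrix.SpecialLinearGroup (Fin n) k := ⟨M, hM⟩
  have h := hT (Matrix.SpecialLinearGroup.toLin_equiv b A)
  rw [diagAction, Matrix.SpecialLinearGroup.toLin_equiv.toLinearMap_eq] at h
  exact h

theorem prod_comp_eq_prod_pow_card {α β R : Type*} [Fintype α] [Fintype β] [DecidableEq β]
    [CommMonoid R] (f : α → β) (D : β → R) :
    ∏ a, D (f a) = ∏ c, D c ^ #{a | f a = c} := by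
  rw [← Finset.prod_fiberwise' univ f D]
  simp

variable [CharZero k]

/-- The diagonal matrix with `2` at `x` and `2⁻¹` at `y` scales the coordinate `I` by 2 to the
difference of the two fiber sizes; in characteristic zero this is 1 only if they agree. -/
theorem card_fiber_eq_of_repr_ne_zero (b : Module.Basis (Fin n) k E) {T : ⨂[k]^N E}
    (hT : ∀ g : SpecialLinearGroup k E, diagAction k E N g T = T) {I : Fin N → Fin n}
    (hI : (Basis.piTensorProduct (fun _ : Fin N => b)).repr T I ≠ 0) (x y : Fin n) :
    #{a | I a = x} = #{a | I a = y} := by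
  rcases eq_or_ne x y with rfl | hxy
  · rfl
  set D : Fin n → k := fun c => (if c = x then 2 else 1) * (if c = y then 2⁻¹ else 1) with hD
  have hdet : (Matrix.diagonal D).det = 1 := by
    rw [Matrix.det_diagonal]
    simp only [hD, Finset.prod_mul_distrib]
    simp
  have h := piTensorProduct_repr_map_diagonal b D T I
  rw [map_toLin_eq_of_forall_diagAction b hT _ hdet] at h
  have h1 : ∏ a, D (I a) = 1 := by
    apply mul_right_cancel₀ hI
    rw [one_mul, ← h]
  simp only [hD, Finset.prod_mul_distrib, Finset.prod_ite, Finset.prod_const, one_pow,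
    mul_one] at h1
  rw [inv_pow, mul_inv_eq_one₀ (pow_ne_zero _ two_ne_zero)] at h1
  exact Nat.pow_right_injective le_rfl (by exact_mod_cast h1)

theorem eq_mul_card_fiber_of_repr_ne_zero (b : Module.Basis (Fin n) k E) {T : ⨂[k]^N E}
    (hT : ∀ g : SpecialLinearGroup k E, diagAction k E N g T = T) {I : Fin N → Fin n}
    (hI : (Basis.piTensorProduct (fun _ : Fin N => b)).repr T I ≠ 0) (x : Fin n) :
    N = n * #{a | I a = x} := by
  have h := Finset.card_eq_sum_card_fiberwise (f := I) (s := univ) (t := univ) (by simp)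
  simp_rw [fun y => card_fiber_eq_of_repr_ne_zero b hT hI y x] at h
  simpa using h

theorem eq_zero_of_forall_diagAction (b : Module.Basis (Fin n) k E) {T : ⨂[k]^N E}
    (hT : ∀ g : SpecialLinearGroup k E, diagAction k E N g T = T) (hN : ¬ n ∣ N) : T = 0 := by
  refine (Basis.piTensorProduct (fun _ : Fin N => b)).ext_elem fun I => ?_
  by_contra hI
  simp only [map_zero, Finsupp.coe_zero, Pi.zero_apply] at hI
  -- A positive degree supplies a value of `I`, hence a fiber to count; degree 0 is divisible by
  -- `n`.
  rcases Nat.eq_zero_or_pos N with rfl | hpos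
  · exact hN (dvd_zero n)
  · exact hN ⟨_, eq_mul_card_fiber_of_repr_ne_zero b hT hI (I ⟨0, hpos⟩)⟩

/-- The identity is multiplicative in the matrix, so diagonal matrices and transvections suffice.
Transvections lie in `SL`; a diagonal matrix scales each surviving coordinate by the `m`-th power of
its determinant, because all fibers have size `m`. -/
theorem map_eq_det_pow_smul (b : Module.Basis (Fin n) k E) {m : ℕ} (hN : N = n * m)
    {T : ⨂[k]^N E} (hT : ∀ g : SpecialLinearGroup k E, diagAction k E N g T = T)
    (φ : E →ₗ[k] E) :
    PiTensorProduct.map (fun _ => φ) T = LinearMap.det φ ^ m • T := by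
  suffices H : ∀ M : Matrix (Fin n) (Fin n) k,
      PiTensorProduct.map (fun _ => Matrix.toLin b b M) T = M.det ^ m • T by
    simpa using H (LinearMap.toMatrix b b φ)
  intro M
  refine Matrix.diagonal_transvection_induction (fun M => PiTensorProduct.map
    (fun _ => Matrix.toLin b b M) T = M.det ^ m • T) M (fun D _ => ?_) (fun t => ?_) ?_
  · refine (Basis.piTensorProduct (fun _ : Fin N => b)).ext_elem fun I => ?_
    rw [piTensorProduct_repr_map_diagonal, map_smul, Finsupp.smul_apply, smul_eq_mul]
    by_cases hI : (Basis.piTensorProduct (fun _ : Fin N => b)).repr T I = 0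
    · simp [hI]
    · congr 1
      rw [prod_comp_eq_prod_pow_card, Matrix.det_diagonal, ← Finset.prod_pow]
      refine Finset.prod_congr rfl fun c _ => ?_
      have h := hN.symm.trans (eq_mul_card_fiber_of_repr_ne_zero b hT hI c)
      rw [← Nat.eq_of_mul_eq_mul_left c.pos h]
  · rw [map_toLin_eq_of_forall_diagAction b hT _ t.det, t.det, one_pow, one_smul]
  · intro A B hA hB
    rw [Matrix.toLin_mul b b b, PiTensorProduct.map_comp, LinearMap.comp_apply, hB, map_smul, hA,
      smul_smul, Matrix.det_mul, mul_pow, mul_comm]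

end TensorInvariants

/-! ### Invariance under points over arbitrary `k`-algebras -/

namespace TensorInvariants

open Equiv Finset

/-- An endomorphism acts on top-degree alternating maps through its determinant. -/
theorem alternatingMap_map_linearMap {R M W ι : Type*} [CommRing R] [AddCommGroup M] [Module R M]
    [AddCommGroup W] [Module R W] [Fintype ι] [DecidableEq ι] (e : Module.Basis ι R M)
    (f : M [⋀^ι]→ₗ[R] W) (φ : M →ₗ[R] M) (v : ι → M) :
    f (fun i => φ (v i)) = LinearMap.det φ • f v := by
  -- A top-degree alternating map is determined by its value on the basis.
  have h : f = (LinearMap.toSpanSingleton R W (f e)).compAlternatingMap e.det := by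
    refine Module.Basis.ext_alternating e fun i hi => ?_
    let σ : Perm ι := Equiv.ofBijective i (Finite.injective_iff_bijective.1 hi)
    change f (e ∘ σ) = (LinearMap.toSpanSingleton R W (f e)).compAlternatingMap e.det (e ∘ σ)
    simp [AlternatingMap.map_perm, Module.Basis.det_self]
  have h' (w : ι → M) : f w = e.det w • f e := by
    conv_lhs => rw [h]
    simp
  rw [h' (fun i => φ (v i)), h' v, smul_smul]
  congr 1
  exact Module.Basis.det_comp e φ v

universe u v

variable {k : Type u} [Field k] {E : Type v} [AddCommGroup E] [Module k E] {n : ℕ}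

section

variable (B : Type u) [CommRing B] [Algebra k B]

@[simp]
theorem extendScalars_tprod {m : ℕ} (v : Fin m → E) :
    extendScalars k E B m (PiTensorProduct.tprod k v) =
      PiTensorProduct.tprod B (fun i => (1 : B) ⊗ₜ[k] v i) := by
  rw [extendScalars, PiTensorProduct.lift.tprod]
  rfl

theorem extendScalars_permAction {m : ℕ} (σ : Perm (Fin m)) (x : ⨂[k]^m E) :
    extendScalars k E B m (permAction σ x) =
      PiTensorProduct.reindex B (fun _ => B ⊗[k] E) σ (extendScalars k E B m x) := by
  induction x using PiTensorProduct.induction_on with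
  | smul_tprod r v =>
    have h (y : ⨂[B]^m (B ⊗[k] E)) : PiTensorProduct.reindex B (fun _ => B ⊗[k] E) σ (r • y) =
        r • PiTensorProduct.reindex B (fun _ => B ⊗[k] E) σ y := by
      rw [← algebraMap_smul B r y, map_smul, algebraMap_smul]
    rw [map_smul, map_smul, map_smul, h, permAction_tprod, extendScalars_tprod,
      extendScalars_tprod, PiTensorProduct.reindex_tprod]
    rfl
  | add x y hx hy => rw [map_add, map_add, map_add, hx, hy, map_add]

theorem extendScalars_concat {a c : ℕ} (x : ⨂[k]^a E) (y : ⨂[k]^c E) :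
    extendScalars k E B (a + c) (concat a c x y) =
      TensorPower.mulEquiv (extendScalars k E B a x ⊗ₜ[B] extendScalars k E B c y) := by
  have hl (r : k) (z : ⨂[B]^a (B ⊗[k] E)) (w : ⨂[B]^c (B ⊗[k] E)) :
      TensorPower.mulEquiv ((r • z) ⊗ₜ[B] w) =
        r • (TensorPower.mulEquiv (z ⊗ₜ[B] w) : ⨂[B]^(a + c) (B ⊗[k] E)) := by
    rw [← algebraMap_smul B r z, ← TensorProduct.smul_tmul', map_smul, algebraMap_smul]
  have hr (r : k) (z : ⨂[B]^a (B ⊗[k] E)) (w : ⨂[B]^c (B ⊗[k] E)) :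
      TensorPower.mulEquiv (z ⊗ₜ[B] (r • w)) =
        r • (TensorPower.mulEquiv (z ⊗ₜ[B] w) : ⨂[B]^(a + c) (B ⊗[k] E)) := by
    rw [← algebraMap_smul B r w, TensorProduct.tmul_smul, map_smul, algebraMap_smul]
  induction x using PiTensorProduct.induction_on with
  | smul_tprod r v =>
    induction y using PiTensorProduct.induction_on with
    | smul_tprod t w =>
      simp only [map_smul, LinearMap.smul_apply, hl, hr, concat_tprod, extendScalars_tprod]
      rw [smul_comm]
      congr 2
      refine Eq.trans ?_ (TensorPower.tprod_mul_tprod B _ _).symm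
      congr 1
      ext i
      refine Fin.addCases (fun i => ?_) (fun i => ?_) i <;> simp
    | add x y hx hy => rw [map_add, map_add, map_add, hx, hy, TensorProduct.tmul_add, map_add]
  | add x y hx hy =>
    rw [map_add, LinearMap.add_apply, map_add, map_add, hx, hy, TensorProduct.add_tmul, map_add]

end

theorem diagAction_mulEquiv {R M : Type*} [CommRing R] [AddCommGroup M] [Module R M] {a c : ℕ}
    (g : SpecialLinearGroup R M) (x : ⨂[R]^a M) (y : ⨂[R]^c M) :
    diagAction R M (a + c) g (TensorPower.mulEquiv (x ⊗ₜ[R] y)) =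
      TensorPower.mulEquiv (diagAction R M a g x ⊗ₜ[R] diagAction R M c g y) := by
  induction x using PiTensorProduct.induction_on with
  | smul_tprod r v =>
    induction y using PiTensorProduct.induction_on with
    | smul_tprod t w =>
      simp only [map_smul, ← TensorProduct.smul_tmul', TensorProduct.tmul_smul]
      congr 2
      have h (v : Fin a → M) (w : Fin c → M) : (TensorPower.mulEquiv
          (PiTensorProduct.tprod R v ⊗ₜ[R] PiTensorProduct.tprod R w) : ⨂[R]^(a + c) M) =
          PiTensorProduct.tprod R (Fin.append v w) := TensorPower.tprod_mul_tprod R v w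
      simp only [diagAction, PiTensorProduct.map_tprod, h]
      congr 1
      ext i
      refine Fin.addCases (fun i => ?_) (fun i => ?_) i <;> simp
    | add x y hx hy => simp only [map_add, hx, hy, TensorProduct.tmul_add]
  | add x y hx hy => simp only [map_add, hx, hy, TensorProduct.add_tmul]

theorem diagAction_alternatization {R M : Type*} [CommRing R] [AddCommGroup M] [Module R M]
    (e : Module.Basis (Fin n) R M) (g : SpecialLinearGroup R M) (w : Fin n → M) :
    diagAction R M n g (MultilinearMap.alternatization (PiTensorProduct.tprod R) w) =
      MultilinearMap.alternatization (PiTensorProduct.tprod R) w := by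
  have hg : diagAction R M n g (MultilinearMap.alternatization (PiTensorProduct.tprod R) w) =
      MultilinearMap.alternatization (PiTensorProduct.tprod R)
        (fun i => (g : M →ₗ[R] M) (w i)) := by
    rw [MultilinearMap.alternatization_apply, MultilinearMap.alternatization_apply, map_sum]
    refine Finset.sum_congr rfl fun σ _ => ?_
    rw [Units.smul_def, map_zsmul, Units.smul_def]
    congr 1
    exact PiTensorProduct.map_tprod _ _
  rw [hg, alternatingMap_map_linearMap e, g.det_eq_one, one_smul]

theorem permAction_mem_slInvariants {m : ℕ} (σ : Perm (Fin m)) {x : ⨂[k]^m E}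
    (hx : x ∈ slInvariants k E m) : permAction σ x ∈ slInvariants k E m := by
  intro B _ _ g
  rw [extendScalars_permAction]
  refine (PiTensorProduct.map_reindex (fun _ => (g : B ⊗[k] E →ₗ[B] B ⊗[k] E)) σ _).trans ?_
  exact congrArg _ (hx B g)

theorem concat_mem_slInvariants {a c : ℕ} {x : ⨂[k]^a E} {y : ⨂[k]^c E}
    (hx : x ∈ slInvariants k E a) (hy : y ∈ slInvariants k E c) :
    concat a c x y ∈ slInvariants k E (a + c) := by
  intro B _ _ g
  rw [extendScalars_concat, diagAction_mulEquiv, hx B g, hy B g]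

/-- Extension of scalars sends antisymmetrized tensors to antisymmetrized tensors, on which `g` acts
by its determinant 1. -/
theorem wedge_le_slInvariants (b : Module.Basis (Fin n) k E) :
    wedge k E n ≤ slInvariants k E n := by
  rw [wedge_eq_span, Submodule.span_le]
  rintro _ ⟨v, rfl⟩ B _ _ g
  have h : extendScalars k E B n
      (exteriorPower.toTensorPower k E n (exteriorPower.ιMulti k n v)) =
      MultilinearMap.alternatization (PiTensorProduct.tprod B)
        (fun i => (1 : B) ⊗ₜ[k] v i) := by
    rw [exteriorPower.toTensorPower_apply_ιMulti, MultilinearMap.alternatization_apply, map_sum]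
    refine Finset.sum_congr rfl fun σ _ => ?_
    rw [Units.smul_def, map_zsmul, extendScalars_tprod]
    rfl
  rw [h]
  exact diagAction_alternatization (b.baseChange B) g _

theorem blockPower_le_slInvariants (b : Module.Basis (Fin n) k E) (m : ℕ) :
    blockPower (wedge k E n) m ≤ slInvariants k E (n * m) := by
  induction m with
  | zero =>
    intro x _ B _ _ g
    have : diagAction B (B ⊗[k] E) (n * 0) g = LinearMap.id := by
      have : IsEmpty (Fin (n * 0)) := by rw [mul_zero]; infer_instance
      ext v
      simp only [diagAction, LinearMap.compMultilinearMap_apply, PiTensorProduct.map_tprod,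
        LinearMap.id_apply]
      congr 1
      exact Subsingleton.elim _ _
    rw [this, LinearMap.id_apply]
  | succ m ih =>
    exact Submodule.map₂_le.2 fun x hx y hy =>
      concat_mem_slInvariants (ih hx) (wedge_le_slInvariants b hy)

/-- Take `B = k` and transport along `k ⊗ E ≃ E`. -/
theorem diagAction_eq_of_mem_slInvariants [FiniteDimensional k E] {m : ℕ} {x : ⨂[k]^m E}
    (hx : x ∈ slInvariants k E m) (g : SpecialLinearGroup k E) : diagAction k E m g x = x := by
  have hcomp (f : k ⊗[k] E →ₗ[k] k ⊗[k] E) (f' : E →ₗ[k] E)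
      (hf : ∀ v, TensorProduct.lid k E (f (1 ⊗ₜ v)) = f' v) :
      PiTensorProduct.map (fun _ => (TensorProduct.lid k E : k ⊗[k] E →ₗ[k] E))
        (PiTensorProduct.map (fun _ => f) (extendScalars k E k m x)) =
      PiTensorProduct.map (fun _ => f') x := by
    have : ((PiTensorProduct.map (fun _ => (TensorProduct.lid k E : k ⊗[k] E →ₗ[k] E))).comp
        (PiTensorProduct.map (fun _ => f))).comp (extendScalars k E k m) =
      PiTensorProduct.map (fun _ : Fin m => f') := by
      ext v
      simp only [LinearMap.compMultilinearMap_apply, LinearMap.comp_apply, extendScalars_tprod,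
        PiTensorProduct.map_tprod, LinearEquiv.coe_coe, hf]
    exact congrArg (fun φ => φ x) this
  have h := congrArg (PiTensorProduct.map
    (fun _ => (TensorProduct.lid k E : k ⊗[k] E →ₗ[k] E))) (hx k (SpecialLinearGroup.baseChange g))
  have h1 := hcomp (SpecialLinearGroup.baseChange (S := k) g : k ⊗[k] E →ₗ[k] k ⊗[k] E) g
    (fun v => by simp [SpecialLinearGroup.baseChange])
  have h2 := hcomp LinearMap.id LinearMap.id (fun v => by simp)
  rw [PiTensorProduct.map_id, PiTensorProduct.map_id] at h2
  exact h1.symm.trans (h.trans h2)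

/-- The top exterior power is spanned by the wedge of the basis, whose image has coordinate 1 at the
index `id`. -/
theorem toTensorPower_injective [CharZero k] (b : Module.Basis (Fin n) k E) :
    Function.Injective (exteriorPower.toTensorPower k E n) := by
  have hspan (x : ⋀[k]^n E) : ∃ c : k, x = c • exteriorPower.ιMulti k n b := by
    have hx : x ∈ Submodule.span k (Set.range (exteriorPower.ιMulti k n (M := E))) := by
      rw [exteriorPower.ιMulti_span]
      trivial
    induction hx using Submodule.span_induction with
    | mem _ h =>
      obtain ⟨v, rfl⟩ := h
      refine ⟨LinearMap.det (b.constr k v), ?_⟩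
      rw [← alternatingMap_map_linearMap b]
      simp
    | zero => exact ⟨0, by simp⟩
    | add x y _ _ hx hy =>
      obtain ⟨c, rfl⟩ := hx
      obtain ⟨d, rfl⟩ := hy
      exact ⟨c + d, (add_smul _ _ _).symm⟩
    | smul r x _ hx =>
      obtain ⟨c, rfl⟩ := hx
      exact ⟨r * c, (mul_smul _ _ _).symm⟩
  rw [injective_iff_map_eq_zero]
  intro x hx
  obtain ⟨c, rfl⟩ := hspan x
  rw [map_smul, ← sum_signCoeff_tprod] at hx
  have h := congrArg (fun y => (Basis.piTensorProduct (fun _ : Fin n => b)).repr y id) hx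
  simp_rw [show ∀ p : Fin n → Fin n, PiTensorProduct.tprod k (b ∘ p) =
    Basis.piTensorProduct (fun _ : Fin n => b) p from
      fun p => (Basis.piTensorProduct_apply _ _).symm] at h
  simp only [map_smul, map_sum, Module.Basis.repr_self, Finsupp.smul_apply, Finsupp.finsetSum_apply,
    Finsupp.single_apply, map_zero, Finsupp.coe_zero, Pi.zero_apply] at h
  simp [signCoeff_id] at h
  rw [h, zero_smul]

end TensorInvariants

open TensorInvariants in
theorem mainTheorem11 (k : Type*) [Field k] [CharZero k]
    (E : Type*) [AddCommGroup E] [Module k E] [FiniteDimensional k E]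
    (n : ℕ) (hn : Module.finrank k E = n) :
    (Function.Injective (exteriorPower.toTensorPower k E n) ∧
      TensorInvariants.slInvariants k E n = TensorInvariants.wedge k E n) ∧
    (∀ m : ℕ, TensorInvariants.slInvariants k E (n * m) =
      ⨆ σ : Equiv.Perm (Fin (n * m)),
        (TensorInvariants.blockPower (TensorInvariants.wedge k E n) m).map
          (TensorInvariants.permAction σ)) ∧
    (∀ m : ℕ, ¬ n ∣ m → TensorInvariants.slInvariants k E m = ⊥) ∧
    (∀ (m : ℕ) (x : ⨂[k]^m E), x ∈ TensorInvariants.slInvariants k E m ↔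
      ∀ g : SpecialLinearGroup k E, TensorInvariants.diagAction k E m g x = x) := by
  let b : Module.Basis (Fin n) k E := Module.finBasisOfFinrankEq k E hn
  -- Only rational points are used here, so together with `hle` this also yields the comparison with
  -- functorial invariants.
  have hfix (m : ℕ) (x : ⨂[k]^(n * m) E)
      (hx : ∀ g : SpecialLinearGroup k E, diagAction k E (n * m) g x = x) :
      x ∈ ⨆ σ : Equiv.Perm (Fin (n * m)),
        (blockPower (wedge k E n) m).map (permAction σ) := by
    obtain ⟨q, s, hs, hdet, hmem⟩ := exists_det_pow_expansion b m
    exact mem_iSup_map_permAction b x (map_eq_det_pow_smul b rfl hx) q s hs hdet _ hmem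
  have hle (m : ℕ) : ⨆ σ : Equiv.Perm (Fin (n * m)),
      (blockPower (wedge k E n) m).map (permAction σ) ≤ slInvariants k E (n * m) := by
    refine iSup_le fun σ => Submodule.map_le_iff_le_comap.2 fun x hx => ?_
    exact permAction_mem_slInvariants σ (blockPower_le_slInvariants b m hx)
  refine ⟨⟨toTensorPower_injective b, le_antisymm (fun x hx => ?_) (wedge_le_slInvariants b)⟩,
    fun m => le_antisymm (fun x hx => hfix m x (diagAction_eq_of_mem_slInvariants hx)) (hle m),
    fun m hm => ?_, fun m x => ⟨diagAction_eq_of_mem_slInvariants, fun hx => ?_⟩⟩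
  · have hx' := diagAction_eq_of_mem_slInvariants hx
    -- One block, with the first power of the determinant: `q = id` and `s = signCoeff`.
    have h := mem_iSup_map_permAction b x (map_eq_det_pow_smul b (mul_one n).symm hx') id signCoeff
      (by simp [signCoeff_id]) (fun φ => by rw [pow_one]; exact det_eq_sum_signCoeff b φ)
      (wedge k E n) (by rw [sum_signCoeff_tprod]; exact LinearMap.mem_range_self _ _)
    exact iSup_le map_permAction_wedge_le h
  · rw [eq_bot_iff]
    intro x hx
    exact eq_zero_of_forall_diagAction b (diagAction_eq_of_mem_slInvariants hx) hm
  · by_cases hm : n ∣ m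
    · obtain ⟨m, rfl⟩ := hm
      exact hle m (hfix m x hx)
    · rw [eq_zero_of_forall_diagAction b hx hm]
      exact Submodule.zero_mem _
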